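/- Theorem. Let $p$ be a prime, let $q = p^h$ be a power of $p$ that is not itself prime, and let $\mathbb{F}_q$ be the field with $q$ elements. Let $k \le 2p-2$ be a nonnegative integer, and let $S$ be a set of vectors of $\mathbb{F}_q^k$ such that every subset of $S$ of size $k$ is a basis of $\mathbb{F}_q^k$. Then $|S| \le q+1$. -/

import Mathlib

/-- A set `B` of vectors is a basis: it is linearly independent and it spans the space. -/
def IsVectorBasis (F : Type*) {V : Type*} [Field F] [AddCommGroup V] [Module F V]
    (B : Set V) : Prop :=
  LinearIndepOn F id B ∧ Submodule.span F B = ⊤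

/-- Every subset of `S` that has exactly `k` elements is a basis of `F ^ k`. -/
def EverySubsetIsBasis {F : Type*} [Field F] {k : ℕ} (S : Finset (Fin k → F)) : Prop :=
  ∀ B : Finset (Fin k → F), B ⊆ S → B.card = k → IsVectorBasis F (B : Set (Fin k → F))

/-! Suppose `|S| = q + 2` with `k = n + 2 ≥ 3`. For `A ⊆ S` of size `k - 1`, the form `u ↦ det (u,
A)` vanishes on the hyperplane spanned by `A` and at no other vector of `S`.

Modulo the span of `k - 2` vectors `C`, the rest of `S` becomes distinct points of a projective
line. Lagrange interpolation there, with the polynomial whose roots are the missed points, gives a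
linear relation: for `G ⊆ S` of size `2k - 3`, the weights `arcWeight S G A` sum to zero over `C ⊂ A
⊆ G` (`EverySubsetIsBasis.sum_arcWeight_eq_zero`). Double counting extends this to sums over `A ⊇ R`
whenever `p` does not divide `k - 1 - |R|` (`sum_star_eq_zero`).

Write `k = m + c` with `m ≤ p`. Inclusion-exclusion (`sum_star_pairs_eq_zero`) leaves a signed sum
over those `A` that consist of a fixed `Q` of size `m - 1` and one vector from each of `c` pairs
`(x, y x)`. Varying the rest of `G` multiplies the terms by products of `c` forms `det (u, A)`. As
every `A` contains `Q`, these `u` can be exchanged for the vectors `x`. This kills every term except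
`A = Q ∪ Y`, which is nonzero: a contradiction (`EverySubsetIsBasis.false_of_params`). -/

/-! ### Interpolation on the projective line -/

open Finset in
/-- Lagrange interpolation for a monic polynomial whose degree is one less than the number
of nodes. -/
lemma sum_prod_sub_mul_inv_prod_sub {ι F : Type*} [Field F] [DecidableEq ι] (s : Finset ι)
    (z : ι → F) (hz : Set.InjOn z s) (T : Finset F) (hT : T.card + 1 = s.card) :
    ∑ a ∈ s, (∏ τ ∈ T, (z a - τ)) * (∏ u ∈ s.erase a, (z a - z u))⁻¹ = 1 := by
  have hm : (∏ τ ∈ T, (Polynomial.X - Polynomial.C τ)).Monic :=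
    Polynomial.monic_prod_of_monic _ _ fun τ _ => Polynomial.monic_X_sub_C τ
  have hd : (∏ τ ∈ T, (Polynomial.X - Polynomial.C τ)).degree = (T.card : WithBot ℕ) := by
    rw [Polynomial.degree_prod]; simp
  have h := Lagrange.leadingCoeff_eq_sum hz (P := ∏ τ ∈ T, (Polynomial.X - Polynomial.C τ))
    (by rw [hd, ← hT]; push_cast; rfl)
  rw [hm.leadingCoeff] at h
  rw [h]
  refine Finset.sum_congr rfl fun a _ => ?_
  rw [div_eq_mul_inv, Polynomial.eval_prod]
  simp

/-- The product of all nonzero differences with a given element of a finite field. -/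
lemma prod_erase_sub_eq_neg_one {F : Type*} [Field F] [Fintype F] [DecidableEq F] (a : F) :
    ∏ z ∈ Finset.univ.erase a, (a - z) = -1 := by
  have h1 : ∏ z ∈ Finset.univ.erase a, (a - z) = ∏ u : Fˣ, (u : F) := by
    symm
    refine Finset.prod_bij (fun u _ => a - (u : F)) ?_ ?_ ?_ ?_
    · intro u _; simp
    · intro u _ v _ h; ext; simpa using h
    · intro z hz
      have hz' : a - z ≠ 0 := sub_ne_zero.2 (Finset.ne_of_mem_erase hz).symm
      exact ⟨Units.mk0 _ hz', Finset.mem_univ _, by simp⟩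
    · intro u _; simp
  rw [h1]
  have := FiniteField.prod_univ_units_id_eq_neg_one (K := F)
  have h2 := congrArg (Units.val) this
  simpa using h2

/-- `B` behaves like the determinant of two vectors of a plane. -/
structure IsPlaneForm {ι F : Type*} [Field F] (B : ι → ι → F) : Prop where
  self : ∀ a, B a a = 0
  anti : ∀ a b, B a b = -B b a
  pluecker : ∀ s a u v, B u v ≠ 0 → B s a * B u v = B u s * B v a - B u a * B v s

lemma IsPlaneForm.eq_slope {ι F : Type*} [Field F] {B : ι → ι → F} (hB : IsPlaneForm B)
    {e₀ e₁ s a : ι} (h : B e₀ e₁ ≠ 0) (hs : B e₀ s ≠ 0) (ha : B e₀ a ≠ 0) :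
    B s a = B e₀ s * (B e₀ a * (B e₀ e₁)⁻¹) * (B e₁ a / B e₀ a - B e₁ s / B e₀ s) := by
  have := hB.pluecker s a e₀ e₁ h
  field_simp
  linear_combination this

lemma IsPlaneForm.slope_injOn {ι F : Type*} [Field F] {B : ι → ι → F}
    (hB : IsPlaneForm B) {S : Set ι} {e₀ e₁ : ι} (h : B e₀ e₁ ≠ 0)
    (h0 : ∀ s ∈ S, B e₀ s ≠ 0) (hS : ∀ s ∈ S, ∀ a ∈ S, s ≠ a → B s a ≠ 0) :
    Set.InjOn (fun s => B e₁ s / B e₀ s) S := by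
  intro s hs a ha hsa
  by_contra hne
  refine hS s hs a ha hne ?_
  rw [hB.eq_slope h (h0 s hs) (h0 a ha)]
  simp only at hsa
  rw [hsa]; simp

/-- The relation between the products over the points of a planar arc and over a subset of it. -/
lemma IsPlaneForm.sum_inv_prod_eq_zero {ι F : Type*} [DecidableEq ι] [Field F] [Fintype F]
    {B : ι → ι → F} (hB : IsPlaneForm B) {S E : Finset ι} (hE : E ⊆ S)
    (hS : ∀ s ∈ S, ∀ a ∈ S, s ≠ a → B s a ≠ 0)
    (hcard : S.card + E.card = Fintype.card F + 3) (hE2 : 2 ≤ E.card) :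
    ∑ a ∈ E, (∏ s ∈ S.erase a, B s a)⁻¹ * (∏ u ∈ E.erase a, B u a)⁻¹ = 0 := by
  classical
  -- `e₀` plays the point at infinity; every other point gets the affine coordinate `z`.
  obtain ⟨e₀, he₀⟩ : E.Nonempty := Finset.card_pos.1 (by omega)
  obtain ⟨e₁, he₁⟩ : (E.erase e₀).Nonempty := by
    apply Finset.card_pos.1; rw [Finset.card_erase_of_mem he₀]; omega
  have he01 : e₁ ≠ e₀ := Finset.ne_of_mem_erase he₁
  have hδ : B e₀ e₁ ≠ 0 := hS _ (hE he₀) _ (hE (Finset.mem_of_mem_erase he₁)) he01.symm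
  set δ := B e₀ e₁ with hδd
  set S₀ := S.erase e₀ with hS₀
  set E₀ := E.erase e₀ with hE₀
  have hES₀ : E₀ ⊆ S₀ := Finset.erase_subset_erase _ hE
  have hlam : ∀ s ∈ S₀, B e₀ s ≠ 0 := fun s hs =>
    hS _ (hE he₀) _ (Finset.mem_of_mem_erase hs) (Finset.ne_of_mem_erase hs).symm
  set z : ι → F := fun s => B e₁ s / B e₀ s with hz
  have hinj : Set.InjOn z S₀ := hB.slope_injOn hδ (fun s hs => hlam s hs)
    (fun s hs a ha => hS s (Finset.mem_of_mem_erase hs) a (Finset.mem_of_mem_erase ha))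
  have hcS : S₀.card + 1 = S.card := Finset.card_erase_add_one (hE he₀)
  have hcE : E₀.card + 1 = E.card := Finset.card_erase_add_one he₀
  -- The coordinates missed by `S₀`. Since `|T| = q - |S₀| = |E₀| - 1`, the monic polynomial with
  -- root set `T` has the degree that interpolation on `E₀` requires.
  set T : Finset F := (S₀.image z)ᶜ with hT
  have hTc : T.card + S₀.card = Fintype.card F := by
    rw [hT, Finset.card_compl, Finset.card_image_of_injOn hinj]
    have := Finset.card_le_univ (S₀.image z)
    rw [Finset.card_image_of_injOn hinj] at this
    omega
  set ΛS := ∏ s ∈ S₀, B e₀ s with hΛS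
  set ΛE := ∏ s ∈ E₀, B e₀ s with hΛE
  have hΛS0 : ΛS ≠ 0 := Finset.prod_ne_zero_iff.2 hlam
  have hΛE0 : ΛE ≠ 0 := Finset.prod_ne_zero_iff.2 fun s hs => hlam s (hES₀ hs)
  have key : ∀ D : Finset ι, D ⊆ S₀ → ∀ a ∈ D, ∏ s ∈ D.erase a, B s a =
      (∏ s ∈ D, B e₀ s) * (B e₀ a)⁻¹ * (B e₀ a * δ⁻¹) ^ (D.card - 1) *
        ∏ s ∈ D.erase a, (z a - z s) := by
    intro D hD a ha
    have h1 : ∏ s ∈ D.erase a, B s a =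
        ∏ s ∈ D.erase a, (B e₀ s * (B e₀ a * δ⁻¹) * (z a - z s)) :=
      Finset.prod_congr rfl fun s hs =>
        hB.eq_slope hδ (hlam s (hD (Finset.mem_of_mem_erase hs))) (hlam a (hD ha))
    rw [h1, Finset.prod_mul_distrib, Finset.prod_mul_distrib, Finset.prod_const,
      Finset.card_erase_of_mem ha, ← Finset.mul_prod_erase D (fun s => B e₀ s) ha]
    have := hlam a (hD ha)
    field_simp
  have hz0 : ∀ D : Finset ι, D ⊆ S₀ → ∀ a ∈ D, ∏ s ∈ D.erase a, (z a - z s) ≠ 0 := by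
    intro D hD a ha
    refine Finset.prod_ne_zero_iff.2 fun s hs => sub_ne_zero.2 fun h => ?_
    exact Finset.ne_of_mem_erase hs
      (hinj (hD (Finset.mem_of_mem_erase hs)) (hD ha) h.symm)
  have hcomp : ∀ a ∈ S₀, (∏ s ∈ S₀.erase a, (z a - z s)) * ∏ τ ∈ T, (z a - τ) = -1 := by
    intro a ha
    rw [← prod_erase_sub_eq_neg_one (z a)]
    have h1 : ∏ s ∈ S₀.erase a, (z a - z s) = ∏ τ ∈ (S₀.erase a).image z, (z a - τ) := by
      rw [Finset.prod_image]
      exact hinj.mono (Finset.coe_subset.2 (Finset.erase_subset _ _))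
    have h2 : Finset.univ.erase (z a) = (S₀.erase a).image z ∪ T := by
      ext τ
      simp only [hT, Finset.mem_erase, Finset.mem_univ, and_true, Finset.mem_union,
        Finset.mem_image, Finset.mem_compl]
      constructor
      · intro hτ
        by_cases h : ∃ s ∈ S₀, z s = τ
        · obtain ⟨s, hs, rfl⟩ := h
          exact Or.inl ⟨s, ⟨fun h => hτ (by rw [h]), hs⟩, rfl⟩
        · exact Or.inr h
      · rintro (⟨s, ⟨hsa, hs⟩, rfl⟩ | h) h'
        · exact hsa (hinj hs ha h')
        · exact h ⟨a, ha, h'.symm⟩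
    rw [h1, h2, Finset.prod_union]
    rw [hT]
    exact (disjoint_compl_right (a := S₀.image z)).mono_left (Finset.image_subset_image (Finset.erase_subset _ _))
  have hterm : ∀ a ∈ E₀, (∏ s ∈ S.erase a, B s a)⁻¹ * (∏ u ∈ E.erase a, B u a)⁻¹ =
      -(ΛS * ΛE)⁻¹ * ((∏ τ ∈ T, (z a - τ)) * (∏ u ∈ E₀.erase a, (z a - z u))⁻¹) := by
    intro a ha
    have haS := hES₀ ha
    have hane : a ≠ e₀ := Finset.ne_of_mem_erase ha
    have hsplit : ∀ D : Finset ι, e₀ ∈ D → ∏ s ∈ D.erase a, B s a =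
        B e₀ a * ∏ s ∈ (D.erase e₀).erase a, B s a := by
      intro D hD
      rw [Finset.erase_right_comm,
        Finset.mul_prod_erase (D.erase a) (fun s => B s a) (Finset.mem_erase.2 ⟨hane.symm, hD⟩)]
    rw [hsplit S (hE he₀), hsplit E he₀, ← hS₀, ← hE₀, key S₀ subset_rfl a haS,
      key E₀ hES₀ a ha, ← hΛS, ← hΛE]
    have hμ : B e₀ a * δ⁻¹ ≠ 0 := mul_ne_zero (hlam a haS) (inv_ne_zero hδ)
    -- The exponents add up to `q - 1`, so the scaling of the point `a` cancels.
    have hpow : (B e₀ a * δ⁻¹) ^ (S₀.card - 1) * (B e₀ a * δ⁻¹) ^ (E₀.card - 1) = 1 := by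
      rw [← pow_add, ← FiniteField.pow_card_sub_one_eq_one _ hμ]
      congr 1
      have : 1 ≤ S₀.card := Finset.card_pos.2 ⟨a, haS⟩
      omega
    set μ₁ := (B e₀ a * δ⁻¹) ^ (S₀.card - 1)
    set μ₂ := (B e₀ a * δ⁻¹) ^ (E₀.card - 1)
    have hl := hlam a haS
    have hzS := hz0 S₀ subset_rfl a haS
    have hzE := hz0 E₀ hES₀ a ha
    have hc := hcomp a haS
    set ZS := ∏ s ∈ S₀.erase a, (z a - z s)
    set ZE := ∏ s ∈ E₀.erase a, (z a - z s)
    set ZT := ∏ τ ∈ T, (z a - τ)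
    have hμ1 : μ₁ ≠ 0 := left_ne_zero_of_mul (hpow ▸ one_ne_zero)
    have hμ2 : μ₂ ≠ 0 := right_ne_zero_of_mul (hpow ▸ one_ne_zero)
    have h1 : (B e₀ a * (ΛS * (B e₀ a)⁻¹ * μ₁ * ZS))⁻¹ *
        (B e₀ a * (ΛE * (B e₀ a)⁻¹ * μ₂ * ZE))⁻¹ = (ΛS * ΛE)⁻¹ * (μ₁ * μ₂)⁻¹ * ZS⁻¹ * ZE⁻¹ := by
      field_simp
    rw [h1, hpow]
    have h2 : ZS⁻¹ = -ZT := by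
      exact inv_eq_of_mul_eq_one_right (by linear_combination -hc)
    rw [h2]; ring
  -- The term at infinity balances the sum of the affine terms, which interpolation evaluates to
  -- `-(ΛS * ΛE)⁻¹`.
  have hterm0 : (∏ s ∈ S.erase e₀, B s e₀)⁻¹ * (∏ u ∈ E.erase e₀, B u e₀)⁻¹ = (ΛS * ΛE)⁻¹ := by
    rw [← hS₀, ← hE₀, ← mul_inv]
    congr 1
    have h1 : ∀ D : Finset ι, ∏ s ∈ D, B s e₀ = (-1) ^ D.card * ∏ s ∈ D, B e₀ s := by
      intro D
      rw [← Finset.prod_const, ← Finset.prod_mul_distrib]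
      exact Finset.prod_congr rfl fun s _ => by rw [hB.anti]; ring
    rw [h1, h1, ← hΛS, ← hΛE]
    have h2 : ((-1 : F)) ^ S₀.card * (-1) ^ E₀.card = 1 := by
      rw [← pow_add, show S₀.card + E₀.card = Fintype.card F + 1 by omega, pow_succ,
        FiniteField.pow_card]
      ring
    linear_combination (ΛS * ΛE) * h2
  rw [← Finset.add_sum_erase E _ he₀, hterm0, ← hE₀, Finset.sum_congr rfl hterm,
    ← Finset.mul_sum, sum_prod_sub_mul_inv_prod_sub E₀ z
      (hinj.mono (Finset.coe_subset.2 hES₀)) T (by omega)]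
  ring

/-! ### Star sums and inclusion-exclusion -/

open Finset in
/-- A function on `(n + 1)`-subsets of `G` that is orthogonal to all stars of `n`-subsets is
orthogonal to the stars of smaller subsets `R` if `n + 1 - #R` is invertible. -/
lemma sum_star_eq_zero {V F : Type*} [DecidableEq V] [Field F] {n : ℕ} {G : Finset V}
    {x : Finset V → F}
    (hC : ∀ C ⊆ G, C.card = n → ∑ a ∈ G \ C, x (insert a C) = 0)
    (R : Finset V) (hR : ((n + 1 - R.card : ℕ) : F) ≠ 0) :
    ∑ A ∈ powersetCard (n + 1) G with R ⊆ A, x A = 0 := by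
  -- Count the pairs `(A, a)` with `a ∈ A \ R` by `C = A \ {a}`; each `A` occurs `n + 1 - |R|`
  -- times.
  have h1 : ∑ A ∈ powersetCard (n + 1) G with R ⊆ A, ∑ _a ∈ A \ R, x A =
      ∑ C ∈ powersetCard n G with R ⊆ C, ∑ a ∈ G \ C, x (insert a C) := by
    rw [Finset.sum_sigma', Finset.sum_sigma']
    refine Finset.sum_bij' (fun p _ => ⟨p.1.erase p.2, p.2⟩) (fun p _ => ⟨insert p.2 p.1, p.2⟩)
      ?_ ?_ ?_ ?_ ?_
    · rintro ⟨A, a⟩ h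
      simp only [mem_sigma, mem_filter, mem_powersetCard, mem_sdiff] at h ⊢
      obtain ⟨⟨⟨hAG, hA⟩, hRA⟩, haA, haR⟩ := h
      refine ⟨⟨⟨(erase_subset _ _).trans hAG, ?_⟩, subset_erase.2 ⟨hRA, haR⟩⟩, hAG haA,
        notMem_erase _ _⟩
      rw [card_erase_of_mem haA]; omega
    · rintro ⟨C, a⟩ h
      simp only [mem_sigma, mem_filter, mem_powersetCard, mem_sdiff] at h ⊢
      obtain ⟨⟨⟨hCG, hC⟩, hRC⟩, haG, haC⟩ := h
      refine ⟨⟨⟨insert_subset haG hCG, ?_⟩, hRC.trans (subset_insert _ _)⟩,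
        mem_insert_self _ _, fun h => haC (hRC h)⟩
      rw [card_insert_of_notMem haC]; omega
    · rintro ⟨A, a⟩ h
      simp only [mem_sigma, mem_sdiff] at h
      simp [insert_erase h.2.1]
    · rintro ⟨C, a⟩ h
      simp only [mem_sigma, mem_sdiff] at h
      simp [erase_insert h.2.2]
    · rintro ⟨A, a⟩ h
      simp only [mem_sigma, mem_sdiff] at h
      simp [insert_erase h.2.1]
  have h2 : ∑ C ∈ powersetCard n G with R ⊆ C, ∑ a ∈ G \ C, x (insert a C) = 0 := by
    refine Finset.sum_eq_zero fun C h => ?_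
    simp only [mem_filter, mem_powersetCard] at h
    exact hC C h.1.1 h.1.2
  have h3 : ∑ A ∈ powersetCard (n + 1) G with R ⊆ A, ∑ _a ∈ A \ R, x A =
      ((n + 1 - R.card : ℕ) : F) * ∑ A ∈ powersetCard (n + 1) G with R ⊆ A, x A := by
    rw [Finset.mul_sum]
    refine Finset.sum_congr rfl fun A h => ?_
    simp only [mem_filter, mem_powersetCard] at h
    rw [Finset.sum_const, card_sdiff_of_subset h.2, h.1.2, nsmul_eq_mul]
  rw [h1, h2] at h3
  exact (mul_eq_zero.1 h3.symm).resolve_left hR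

/-- The indicator of membership, with values in `F`. -/
def memInd {V : Type*} [DecidableEq V] (F : Type*) [Field F] (A : Finset V) (v : V) : F :=
  if v ∈ A then 1 else 0

open Finset in
-- The sets that avoid `e` contribute the star of `R` minus the star of `R ∪ {e}`. Only stars of
-- sets of size between `c` and `n` enter.
lemma sum_star_avoid_eq_zero {V F : Type*} [DecidableEq V] [Field F] {n c : ℕ} {G : Finset V}
    {x : Finset V → F}
    (hR : ∀ R ⊆ G, c ≤ R.card → R.card ≤ n →
      ∑ A ∈ powersetCard (n + 1) G with R ⊆ A, x A = 0)
    (E : Finset V) (hE : E ⊆ G) : ∀ R ⊆ G, Disjoint R E → c ≤ R.card → R.card + E.card ≤ n →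
      ∑ A ∈ powersetCard (n + 1) G with R ⊆ A, (∏ e ∈ E, (1 - memInd F A e)) * x A = 0 := by
  induction E using Finset.induction_on with
  | empty => intro R hRG _ h1 h2; simpa using hR R hRG h1 (by simpa using h2)
  | insert e E he ih =>
    intro R hRG hdis h1 h2
    rw [card_insert_of_notMem he] at h2
    rw [disjoint_insert_right] at hdis
    rw [insert_subset_iff] at hE
    have i1 := ih hE.2 R hRG hdis.2 h1 (by omega)
    have i2 := ih hE.2 (insert e R) (insert_subset hE.1 hRG)
      (disjoint_insert_left.2 ⟨he, hdis.2⟩)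
      (h1.trans (card_le_card (subset_insert _ _)))
      (by rw [card_insert_of_notMem hdis.1]; omega)
    rw [← sub_eq_zero.2 (i1.trans i2.symm), sum_filter, sum_filter, sum_filter,
      ← sum_sub_distrib]
    refine sum_congr rfl fun A _ => ?_
    simp only [prod_insert he, insert_subset_iff]
    by_cases heA : e ∈ A <;> by_cases hRA : R ⊆ A <;> simp [memInd, heA, hRA]

open Finset in
/-- Inclusion-exclusion over the pairs `(v, y v)`, `v ∈ X`, and the points of `E`. -/
lemma sum_star_pairs_eq_zero {V F : Type*} [DecidableEq V] [Field F] {n c : ℕ} {G : Finset V}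
    {x : Finset V → F}
    (hR : ∀ R ⊆ G, c ≤ R.card → R.card ≤ n →
      ∑ A ∈ powersetCard (n + 1) G with R ⊆ A, x A = 0)
    (E : Finset V) (hE : E ⊆ G) (y : V → V) (X : Finset V) (hX : X ⊆ G)
    (hyX : ∀ v ∈ X, y v ∈ G) (hinj : Set.InjOn y X) (hXE : Disjoint X E)
    (hXy : ∀ v ∈ X, ∀ w ∈ X, y v ≠ w) (hyE : ∀ v ∈ X, y v ∉ E) :
    ∀ R ⊆ G, Disjoint R E → Disjoint R X → (∀ v ∈ X, y v ∉ R) →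
      c ≤ R.card + X.card → R.card + X.card + E.card ≤ n →
      ∑ A ∈ powersetCard (n + 1) G with R ⊆ A,
        (∏ v ∈ X, (memInd F A v - memInd F A (y v))) *
          ((∏ e ∈ E, (1 - memInd F A e)) * x A) = 0 := by
  induction X using Finset.induction_on with
  | empty =>
    intro R hRG hd _ _ h1 h2
    simpa using sum_star_avoid_eq_zero hR E hE R hRG hd (by simpa using h1) (by simpa using h2)
  | insert v X hv ih =>
    intro R hRG hdE hdX hyR h1 h2
    rw [card_insert_of_notMem hv] at h1 h2
    rw [disjoint_insert_right] at hdX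
    rw [insert_subset_iff] at hX
    rw [disjoint_insert_left] at hXE
    simp only [mem_insert, forall_eq_or_imp] at hyX hXy hyE hyR
    have ih' := ih hX.2 hyX.2 (hinj.mono (coe_subset.2 (subset_insert _ _))) hXE.2
      (fun w hw => (hXy.2 w hw).2) hyE.2
    have i1 := ih' (insert v R) (insert_subset hX.1 hRG) (disjoint_insert_left.2 ⟨hXE.1, hdE⟩)
      (disjoint_insert_left.2 ⟨hv, hdX.2⟩)
      (fun w hw h => (mem_insert.1 h).elim (hXy.2 w hw).1 (hyR.2 w hw))
      (by rw [card_insert_of_notMem hdX.1]; omega) (by rw [card_insert_of_notMem hdX.1]; omega)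
    have i2 := ih' (insert (y v) R) (insert_subset hyX.1 hRG)
      (disjoint_insert_left.2 ⟨hyE.1, hdE⟩)
      (disjoint_insert_left.2 ⟨fun h => hXy.1.2 _ h rfl, hdX.2⟩)
      (fun w hw h => (mem_insert.1 h).elim
        (fun h => hv (hinj (by simp [hw]) (by simp) h ▸ hw)) (hyR.2 w hw))
      (by rw [card_insert_of_notMem hyR.1]; omega) (by rw [card_insert_of_notMem hyR.1]; omega)
    rw [← sub_eq_zero.2 (i1.trans i2.symm), sum_filter, sum_filter, sum_filter,
      ← sum_sub_distrib]
    refine sum_congr rfl fun A _ => ?_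
    simp only [prod_insert hv, insert_subset_iff]
    by_cases hvA : v ∈ A <;> by_cases hyA : y v ∈ A <;> by_cases hRA : R ⊆ A <;>
      simp [memInd, hvA, hyA, hRA]

/-! ### Determinants as linear and bilinear forms -/

section Forms

variable {F : Type*} [Field F] {n : ℕ}

/-- An enumeration of the elements of a finite set of size `m`. -/
noncomputable def enumOfCard {V : Type*} [Zero V] (m : ℕ) (A : Finset V) : Fin m → V :=
  if h : A.card = m then fun i => (A.equivFinOfCardEq h).symm i else 0

lemma enumOfCard_injective {V : Type*} [Zero V] {m : ℕ} {A : Finset V} (h : A.card = m) :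
    Function.Injective (enumOfCard m A) := by
  intro i j hij
  simp only [enumOfCard, h, dite_true] at hij
  exact (A.equivFinOfCardEq h).symm.injective (Subtype.ext hij)

lemma range_enumOfCard {V : Type*} [Zero V] {m : ℕ} {A : Finset V} (h : A.card = m) :
    Set.range (enumOfCard m A) = A := by
  ext v
  simp only [enumOfCard, h, dite_true, Set.mem_range, Finset.mem_coe]
  constructor
  · rintro ⟨i, rfl⟩; exact Subtype.prop _
  · intro hv; exact ⟨A.equivFinOfCardEq h ⟨v, hv⟩, by simp⟩

lemma exists_perm_of_range_eq {ι V : Type*} {v w : ι → V} (hv : Function.Injective v)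
    (hw : Function.Injective w) (h : Set.range v = Set.range w) :
    ∃ σ : Equiv.Perm ι, v = w ∘ σ := by
  refine ⟨(Equiv.ofInjective v hv).trans
    ((Equiv.setCongr h).trans (Equiv.ofInjective w hw).symm), ?_⟩
  funext i
  simp [Equiv.apply_ofInjective_symm]

lemma AlternatingMap.map_vecCons_self {V : Type*} [AddCommGroup V] [Module F V] {m : ℕ}
    (f : V [⋀^Fin (m + 1)]→ₗ[F] F) (v : Fin m → V) (i : Fin m) :
    f (Matrix.vecCons (v i) v) = 0 :=
  f.map_eq_zero_of_eq (Matrix.vecCons (v i) v) (i := 0) (j := i.succ) (by simp)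
    (Fin.succ_ne_zero i).symm

/-- The linear form `u ↦ det (u, A)` whose kernel is the hyperplane spanned by `A`. -/
noncomputable def hyperplaneForm (A : Finset (Fin (n + 1) → F)) : (Fin (n + 1) → F) →ₗ[F] F where
  toFun u := Matrix.detRowAlternating (Matrix.vecCons u (enumOfCard n A))
  map_add' _ _ := AlternatingMap.map_vecCons_add _ _ _ _
  map_smul' _ _ := AlternatingMap.map_vecCons_smul _ _ _ _

/-- The form `(u, v) ↦ det (u, v, C)`. -/
noncomputable def pencilForm (C : Finset (Fin (n + 2) → F)) (u v : Fin (n + 2) → F) : F :=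
  Matrix.detRowAlternating (Matrix.vecCons u (Matrix.vecCons v (enumOfCard n C)))

lemma detRowAlternating_ne_zero_iff {v : Fin n → Fin n → F} :
    Matrix.detRowAlternating v ≠ 0 ↔ LinearIndependent F v := by
  have : Matrix.detRowAlternating v = (Matrix.of v).det := rfl
  rw [this, ← isUnit_iff_ne_zero, ← Matrix.isUnit_iff_isUnit_det,
    ← Matrix.linearIndependent_rows_iff_isUnit]
  rfl

lemma hyperplaneForm_eq_zero {A : Finset (Fin (n + 1) → F)} (hA : A.card = n)
    {u : Fin (n + 1) → F} (hu : u ∈ A) : hyperplaneForm A u = 0 := by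
  obtain ⟨i, rfl⟩ : u ∈ Set.range (enumOfCard n A) := by rw [range_enumOfCard hA]; exact hu
  exact AlternatingMap.map_vecCons_self Matrix.detRowAlternating (enumOfCard n A) i

lemma hyperplaneForm_ne_zero [DecidableEq (Fin (n + 1) → F)] {A : Finset (Fin (n + 1) → F)} (hA : A.card = n)
    {u : Fin (n + 1) → F} (hu : u ∉ A)
    (h : LinearIndepOn F id ((insert u A : Finset (Fin (n + 1) → F)) : Set (Fin (n + 1) → F))) :
    hyperplaneForm A u ≠ 0 := by
  change Matrix.detRowAlternating _ ≠ 0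
  rw [detRowAlternating_ne_zero_iff]
  have hinj : Function.Injective (Matrix.vecCons u (enumOfCard n A)) := by
    rw [Matrix.vecCons, Fin.cons_injective_iff, range_enumOfCard hA]
    exact ⟨hu, enumOfCard_injective hA⟩
  rw [← linearIndepOn_id_range_iff hinj, Matrix.range_cons, range_enumOfCard hA]
  simpa using h

/-- The enumerations of `C` and of `C ∪ {a}` are chosen independently, so they agree only up to a
permutation; its sign `ε` does not depend on `u`. -/
lemma hyperplaneForm_insert [DecidableEq (Fin (n + 2) → F)] {C : Finset (Fin (n + 2) → F)} (hC : C.card = n)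
    {a : Fin (n + 2) → F} (ha : a ∉ C) : ∃ ε : F, (ε = 1 ∨ ε = -1) ∧
      ∀ u, hyperplaneForm (insert a C) u = ε * pencilForm C u a := by
  have hcard : (insert a C).card = n + 1 := by rw [Finset.card_insert_of_notMem ha, hC]
  have hinj : Function.Injective (Matrix.vecCons a (enumOfCard n C)) := by
    rw [Matrix.vecCons, Fin.cons_injective_iff, range_enumOfCard hC]
    exact ⟨ha, enumOfCard_injective hC⟩
  obtain ⟨σ, hσ⟩ := exists_perm_of_range_eq (enumOfCard_injective hcard) hinj (by
    rw [range_enumOfCard hcard, Matrix.range_cons, range_enumOfCard hC]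
    simp)
  refine ⟨((Equiv.Perm.sign σ : ℤ) : F), ?_, fun u => ?_⟩
  · rcases Int.units_eq_one_or (Equiv.Perm.sign σ) with h | h <;> simp [h]
  · change (Matrix.detRowAlternating.curryLeft u) (enumOfCard (n + 1) (insert a C)) = _
    rw [hσ, AlternatingMap.map_perm, Units.smul_def, zsmul_eq_mul]
    rfl

lemma pencilForm_isPlaneForm (C : Finset (Fin (n + 2) → F)) : IsPlaneForm (pencilForm C) := by
  have hself : ∀ a, pencilForm C a a = 0 := fun a =>
    AlternatingMap.map_eq_zero_of_eq _ _ (i := 0) (j := 1) (by simp) (by simp)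
  let L : (Fin (n + 2) → F) → (Fin (n + 2) → F) →ₗ[F] F := fun u =>
    { toFun := fun v => (Matrix.detRowAlternating.curryLeft u)
        (Matrix.vecCons v (enumOfCard n C))
      map_add' := fun v w => AlternatingMap.map_vecCons_add _ _ _ _
      map_smul' := fun c v => AlternatingMap.map_vecCons_smul _ _ _ _ }
  have hL : ∀ u v, pencilForm C u v = L u v := fun u v => rfl
  have hadd : ∀ u v w, L (u + v) w = L u w + L v w := fun u v w =>
    AlternatingMap.map_vecCons_add Matrix.detRowAlternating
      (Matrix.vecCons w (enumOfCard n C)) u v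
  have hanti : ∀ a b, pencilForm C a b = -pencilForm C b a := by
    intro a b
    have h := hself (a + b)
    rw [hL, hadd, map_add, map_add, ← hL, ← hL, ← hL, ← hL, hself, hself] at h
    linear_combination h
  refine ⟨hself, hanti, fun s a u v huv => ?_⟩
  have hli : LinearIndependent F (Matrix.vecCons u (Matrix.vecCons v (enumOfCard n C))) :=
    detRowAlternating_ne_zero_iff.1 huv
  have hspan := hli.span_eq_top_of_card_eq_finrank (by simp)
  -- The Plücker relation as an identity of linear forms, checked on the basis `u, v, C`.
  have h0 : pencilForm C u v • L a + pencilForm C v a • L u - pencilForm C u a • L v = 0 := by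
    refine LinearMap.ext_on_range hspan fun i => ?_
    refine Fin.cases ?_ (fun i => Fin.cases ?_ (fun i => ?_) i) i
    · simp only [Matrix.cons_val_zero, LinearMap.sub_apply, LinearMap.add_apply,
        LinearMap.smul_apply, smul_eq_mul, ← hL, hself, LinearMap.zero_apply]
      rw [hanti a u, hanti v u]; ring
    · simp only [Matrix.cons_val_succ, Matrix.cons_val_zero, LinearMap.sub_apply,
        LinearMap.add_apply, LinearMap.smul_apply, smul_eq_mul, ← hL, hself, LinearMap.zero_apply]
      rw [hanti a v]; ring
    · have hz : ∀ w, L w (enumOfCard n C i) = 0 := fun w =>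
        AlternatingMap.map_vecCons_self (Matrix.detRowAlternating.curryLeft w) (enumOfCard n C) i
      simp [hz]
  have h1 := LinearMap.congr_fun h0 s
  simp only [LinearMap.sub_apply, LinearMap.add_apply,
        LinearMap.smul_apply, smul_eq_mul, ← hL, LinearMap.zero_apply] at h1
  rw [hanti s a]
  linear_combination -h1

end Forms

/-! ### Weights on arcs and the contradiction -/

section Arcs

variable {F : Type*} [Field F] {n : ℕ}

open Finset

lemma EverySubsetIsBasis.mono {k : ℕ} {S S' : Finset (Fin k → F)} (hS : EverySubsetIsBasis S)
    (h : S' ⊆ S) : EverySubsetIsBasis S' := fun B hB hc => hS B (hB.trans h) hc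

lemma EverySubsetIsBasis.hyperplaneForm_ne_zero {S : Finset (Fin (n + 1) → F)}
    (hS : EverySubsetIsBasis S) {A : Finset (Fin (n + 1) → F)} (hAS : A ⊆ S) (hA : A.card = n)
    {u : Fin (n + 1) → F} (hu : u ∈ S) (huA : u ∉ A) : hyperplaneForm A u ≠ 0 := by
  classical
  exact _root_.hyperplaneForm_ne_zero hA huA
    (hS _ (insert_subset hu hAS) (by rw [card_insert_of_notMem huA, hA])).1

lemma EverySubsetIsBasis.pencilForm_ne_zero {S : Finset (Fin (n + 2) → F)}
    (hS : EverySubsetIsBasis S) {C : Finset (Fin (n + 2) → F)} (hCS : C ⊆ S) (hC : C.card = n)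
    {u v : Fin (n + 2) → F} (hu : u ∈ S) (huC : u ∉ C) (hv : v ∈ S) (hvC : v ∉ C)
    (huv : u ≠ v) : pencilForm C u v ≠ 0 := by
  classical
  obtain ⟨ε, -, h⟩ := hyperplaneForm_insert hC hvC
  have := hS.hyperplaneForm_ne_zero (insert_subset hv hCS)
    (by rw [card_insert_of_notMem hvC, hC]) hu (by simp [huv, huC])
  rw [h] at this
  exact right_ne_zero_of_mul this

/-- The product of the inverses of all `det (s, A)`, with `s` in `S` and in `G`. -/
noncomputable def arcWeight [DecidableEq (Fin (n + 1) → F)] (S G A : Finset (Fin (n + 1) → F)) :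
    F :=
  (∏ s ∈ S \ A, hyperplaneForm A s)⁻¹ * (∏ u ∈ G \ A, hyperplaneForm A u)⁻¹

/-- The planar relation for `pencilForm C` on `S \ C` and `G \ C`, whose sizes `q + 2 - n` and `n +
1` add up to `q + 3`. -/
lemma EverySubsetIsBasis.sum_arcWeight_eq_zero [DecidableEq (Fin (n + 2) → F)] [Fintype F]
    {S : Finset (Fin (n + 2) → F)} (hS : EverySubsetIsBasis S)
    (hcard : S.card = Fintype.card F + 2) (hn : 1 ≤ n) {G C : Finset (Fin (n + 2) → F)}
    (hGS : G ⊆ S) (hG : G.card = 2 * n + 1) (hCG : C ⊆ G) (hC : C.card = n) :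
    ∑ a ∈ G \ C, arcWeight S G (insert a C) = 0 := by
  have hE : (G \ C).card = n + 1 := by rw [card_sdiff_of_subset hCG]; omega
  have hSC : (S \ C).card + n = Fintype.card F + 2 := by
    rw [card_sdiff_of_subset (hCG.trans hGS), hC, ← hcard]
    have := card_le_card (hCG.trans hGS); omega
  rw [← (pencilForm_isPlaneForm C).sum_inv_prod_eq_zero
    (sdiff_subset_sdiff hGS (subset_refl C)) (fun s hs a ha hsa => by
      rw [mem_sdiff] at hs ha
      exact hS.pencilForm_ne_zero (hCG.trans hGS) hC hs.1 hs.2 ha.1 ha.2 hsa)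
    (by omega) (by omega)]
  refine sum_congr rfl fun a ha => ?_
  have haS : a ∈ S \ C := sdiff_subset_sdiff hGS (subset_refl C) ha
  obtain ⟨ε, hε, h⟩ := hyperplaneForm_insert hC (mem_sdiff.1 ha).2
  rw [arcWeight, sdiff_insert, sdiff_insert, ← mul_inv, ← mul_inv]
  simp only [h, prod_mul_distrib, prod_const]
  -- There are `q + 1` factors in all, and `ε ^ (q + 1) = ε ^ 2 = 1`: the arbitrary orderings do no
  -- harm.
  have hpow : ε ^ ((S \ C).erase a).card * ε ^ ((G \ C).erase a).card = 1 := by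
    have hpos : 0 < (S \ C).card := card_pos.2 ⟨a, haS⟩
    rw [← pow_add, card_erase_of_mem haS, card_erase_of_mem ha,
      show (S \ C).card - 1 + ((G \ C).card - 1) = Fintype.card F + 1 by omega, pow_succ,
      FiniteField.pow_card]
    rcases hε with rfl | rfl <;> ring
  congr 1
  linear_combination (∏ s ∈ (S \ C).erase a, pencilForm C s a) *
    (∏ s ∈ (G \ C).erase a, pencilForm C s a) * hpow

/-- Sets that take part in a nonzero product of differences over the pairs `(v, y v)`. -/
lemma subset_of_prod_memInd_sub_ne_zero {V : Type*} [DecidableEq V] {Q X Y A : Finset V}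
    {y : V → V} (hY : X.image y = Y) (hA : A ⊆ Q ∪ X ∪ Y)
    (hcard : A.card = Q.card + X.card)
    (h : ∏ v ∈ X, (memInd F A v - memInd F A (y v)) ≠ 0) :
    Q ⊆ A ∧ (Disjoint X A → A = Q ∪ Y) := by
  rw [prod_ne_zero_iff] at h
  have h1 : ∀ v ∈ X, y v ∈ A → v ∉ A := fun v hv h1 h2 => h v hv (by simp [memInd, h1, h2])
  have h2 : ∀ v ∈ X, v ∉ A → y v ∈ A := fun v hv h1 => by
    by_contra h2; exact h v hv (by simp [memInd, h1, h2])
  -- `A` meets each pair exactly once, so at most `|X|` of its elements lie outside `Q`; its size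
  -- then forces `Q ⊆ A`.
  have hAY : A ∩ Y ⊆ (X \ A).image y := by
    intro w hw
    rw [mem_inter, ← hY, mem_image] at hw
    obtain ⟨hwA, v, hv, rfl⟩ := hw
    exact mem_image_of_mem _ (mem_sdiff.2 ⟨hv, h1 v hv hwA⟩)
  have hc1 : (A ∩ Y).card ≤ (X \ A).card := (card_le_card hAY).trans card_image_le
  have hc2 : (X \ A).card + (A ∩ X).card = X.card := by
    rw [inter_comm, card_sdiff_add_card_inter]
  have hc3 : A.card ≤ (A ∩ Q).card + (A ∩ X).card + (A ∩ Y).card := by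
    have : A = (A ∩ Q) ∪ (A ∩ X) ∪ (A ∩ Y) := by
      rw [← inter_union_distrib_left, ← inter_union_distrib_left, inter_eq_left.2 hA]
    calc A.card = ((A ∩ Q) ∪ (A ∩ X) ∪ (A ∩ Y)).card := by rw [← this]
      _ ≤ _ := (card_union_le _ _).trans (Nat.add_le_add_right (card_union_le _ _) _)
  have hQ : Q ⊆ A := by
    have : A ∩ Q = Q := eq_of_subset_of_card_le inter_subset_right (by omega)
    rw [← this]; exact inter_subset_left
  refine ⟨hQ, fun hd => ?_⟩
  refine Subset.antisymm (fun w hw => ?_) (union_subset hQ ?_)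
  · have := hA hw
    simp only [mem_union] at this ⊢
    rcases this with (h | h) | h
    · exact Or.inl h
    · exact absurd hw (disjoint_left.1 hd h)
    · exact Or.inr h
  · rw [← hY, image_subset_iff]
    exact fun v hv => h2 v hv (disjoint_left.1 hd hv)

/-- Inclusion-exclusion with `G = H ∪ E`, where `H = Q ∪ X ∪ Y`. Sets that meet `E` drop out, and
for the others the factors from `E` split off the weight, which makes the dependence on `E`
explicit. -/
lemma sum_arcWeight_pairs_eq_zero [DecidableEq (Fin (n + 2) → F)] [Fintype F] {p : ℕ}
    [CharP F p] {S : Finset (Fin (n + 2) → F)} (hS : EverySubsetIsBasis S)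
    (hcard : S.card = Fintype.card F + 2) (hn : 1 ≤ n) {m : ℕ} (hmp : m ≤ p)
    {Q X Y E : Finset (Fin (n + 2) → F)} (hm : n + 2 = m + X.card)
    (hQS : Q ⊆ S) (hXS : X ⊆ S) (hYS : Y ⊆ S) (hES : E ⊆ S)
    (hQ : Q.card + 1 = m) (hE : E.card + 2 = m)
    {y : (Fin (n + 2) → F) → (Fin (n + 2) → F)} (hinj : Set.InjOn y X) (hY : X.image y = Y)
    (hQX : Disjoint Q X) (hQXY : Disjoint (Q ∪ X) Y) (hHE : Disjoint (Q ∪ X ∪ Y) E) :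
    ∑ A ∈ powersetCard (n + 1) (Q ∪ X ∪ Y),
      (∏ v ∈ X, (memInd F A v - memInd F A (y v))) *
        (arcWeight S (Q ∪ X ∪ Y) A * (∏ u ∈ E, hyperplaneForm A u)⁻¹) = 0 := by
  set H := Q ∪ X ∪ Y with hH
  have hYc : Y.card = X.card := by rw [← hY, card_image_of_injOn hinj]
  have hGc : (H ∪ E).card = 2 * n + 1 := by
    rw [card_union_of_disjoint hHE, hH, card_union_of_disjoint hQXY, card_union_of_disjoint hQX]
    omega
  have hGS : H ∪ E ⊆ S := union_subset (union_subset (union_subset hQS hXS) hYS) hES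
  have hR : ∀ R ⊆ H ∪ E, X.card ≤ R.card → R.card ≤ n →
      ∑ A ∈ powersetCard (n + 1) (H ∪ E) with R ⊆ A, arcWeight S (H ∪ E) A = 0 := by
    intro R _ h1 h2
    refine sum_star_eq_zero (fun C hC hCc => hS.sum_arcWeight_eq_zero hcard hn hGS hGc hC hCc) R ?_
    -- From `|X| ≤ |R| ≤ n` follows `1 ≤ n + 1 - |R| ≤ m - 1 < p`.
    rw [Ne, CharP.cast_eq_zero_iff F p]
    intro hdvd
    have := Nat.le_of_dvd (by omega) hdvd
    omega
  have hXH : X ⊆ H := subset_union_right.trans subset_union_left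
  have hYH : Y ⊆ H := subset_union_right
  have hyY : ∀ v ∈ X, y v ∈ Y := fun v hv => hY ▸ mem_image_of_mem _ hv
  have key := sum_star_pairs_eq_zero hR E subset_union_right y X (hXH.trans subset_union_left)
    (fun v hv => mem_union_left _ (hYH (hyY v hv))) hinj (hHE.mono_left hXH)
    (fun v hv w hw h => disjoint_left.1 hQXY (mem_union_right _ hw) (h ▸ hyY v hv))
    (fun v hv => disjoint_left.1 hHE (hYH (hyY v hv)))
    ∅ (empty_subset _) (disjoint_empty_left _) (disjoint_empty_left _) (by simp) (by simp)
    (by rw [card_empty]; omega)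
  simp only [empty_subset, filter_true] at key
  rw [← key]
  refine sum_subset_zero_on_sdiff (powersetCard_mono subset_union_left) ?_ ?_
  · intro A hA
    rw [mem_sdiff, mem_powersetCard, mem_powersetCard] at hA
    obtain ⟨⟨hAG, hAc⟩, hAH⟩ := hA
    obtain ⟨e, heA, heH⟩ := not_subset.1 fun h => hAH ⟨h, hAc⟩
    have heE : e ∈ E := (mem_union.1 (hAG heA)).resolve_left heH
    rw [prod_eq_zero (i := e) heE (by simp [memInd, heA])]
    simp
  · intro A hA
    rw [mem_powersetCard] at hA
    have hAE : Disjoint A E := hHE.mono_left hA.1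
    have h1 : ∏ e ∈ E, (1 - memInd F A e) = 1 :=
      prod_eq_one fun e he => by simp [memInd, disjoint_right.1 hAE he]
    have h2 : (H ∪ E) \ A = (H \ A) ∪ E := by
      rw [union_sdiff_distrib, sdiff_eq_self_of_disjoint hAE.symm]
    rw [h1, one_mul, arcWeight, arcWeight, h2,
      prod_union (hHE.mono_left sdiff_subset), mul_inv, mul_assoc]

lemma EverySubsetIsBasis.false_of_params [Fintype F] {p : ℕ}
    [CharP F p] {S : Finset (Fin (n + 2) → F)} (hS : EverySubsetIsBasis S)
    (hcard : S.card = Fintype.card F + 2) (hn : 1 ≤ n) {m c : ℕ} (hmp : m ≤ p)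
    (hm : n + 2 = m + c) (hm2 : 2 ≤ m) (hc : c = 0 ∨ c + 2 ≤ m)
    (hsize : 2 * m + 3 * c ≤ Fintype.card F + 5) : False := by
  classical
  obtain ⟨Q, hQS, hQ⟩ := exists_subset_card_eq (s := S) (n := m - 1) (by omega)
  obtain ⟨X, hX', hX⟩ := exists_subset_card_eq (s := S \ Q) (n := c)
    (by rw [card_sdiff_of_subset hQS]; omega)
  have hXS : X ⊆ S := hX'.trans sdiff_subset
  have hQX : Disjoint Q X := (disjoint_sdiff (s := Q) (t := S)).mono_right hX'
  have hQXc : (Q ∪ X).card = m - 1 + c := by rw [card_union_of_disjoint hQX, hQ, hX]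
  obtain ⟨Y, hY', hYc⟩ := exists_subset_card_eq (s := S \ (Q ∪ X)) (n := c)
    (by rw [card_sdiff_of_subset (union_subset hQS hXS)]; omega)
  have hYS : Y ⊆ S := hY'.trans sdiff_subset
  have hQXY : Disjoint (Q ∪ X) Y := disjoint_sdiff.mono_right hY'
  have hHc : (Q ∪ X ∪ Y).card = m - 1 + c + c := by
    rw [card_union_of_disjoint hQXY, hQXc, hYc]
  have hHS : Q ∪ X ∪ Y ⊆ S := union_subset (union_subset hQS hXS) hYS
  -- A reservoir: removing any `c` vectors from `W` leaves an admissible `E` of size `m - 2`. The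
  -- bound `hsize` makes `W` fit into `S` outside `H`.
  obtain ⟨W, hW', hWc⟩ := exists_subset_card_eq (s := S \ (Q ∪ X ∪ Y)) (n := c + m - 2)
    (by rw [card_sdiff_of_subset hHS]; omega)
  have hWS : W ⊆ S := hW'.trans sdiff_subset
  have hHW : Disjoint (Q ∪ X ∪ Y) W := disjoint_sdiff.mono_right hW'
  obtain ⟨y, hinj, hY⟩ : ∃ y : (Fin (n + 2) → F) → (Fin (n + 2) → F),
      Set.InjOn y X ∧ X.image y = Y := by
    let e := Finset.equivOfCardEq (hX.trans hYc.symm)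
    refine ⟨fun v => if h : v ∈ X then e ⟨v, h⟩ else v, ?_, ?_⟩
    · intro v hv w hw h
      rw [mem_coe] at hv hw
      simp only [hv, hw, dite_true] at h
      simpa using e.injective (Subtype.ext h)
    · ext w
      rw [mem_image]
      constructor
      · rintro ⟨v, hv, rfl⟩
        simp only [hv, dite_true]
        exact Subtype.prop _
      · intro hw
        refine ⟨e.symm ⟨w, hw⟩, Subtype.prop _, ?_⟩
        simp
  set H := Q ∪ X ∪ Y with hH
  let f : Finset (Fin (n + 2) → F) → F := fun A => ∏ v ∈ X, (memInd F A v - memInd F A (y v))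
  let g : Finset (Fin (n + 2) → F) → F := fun A =>
    f A * (arcWeight S H A * (∏ u ∈ W, hyperplaneForm A u)⁻¹)
  have hne : ∀ A ∈ powersetCard (n + 1) H, ∀ u ∈ S, u ∉ A → hyperplaneForm A u ≠ 0 := by
    intro A hA u hu huA
    rw [mem_powersetCard] at hA
    exact hS.hyperplaneForm_ne_zero (hA.1.trans hHS) hA.2 hu huA
  have hgQ : ∀ A ∈ powersetCard (n + 1) H, g A ≠ 0 → Q ⊆ A ∧ (Disjoint X A → A = Q ∪ Y) := by
    intro A hA h
    rw [mem_powersetCard] at hA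
    exact subset_of_prod_memInd_sub_ne_zero hY hA.1 (by omega) (left_ne_zero_of_mul h)
  -- For `Ω = ∅` this is the pair relation with `E = W \ T`, as the factors from `T` cancel. The
  -- induction trades vectors of `T` for vectors of `X`.
  have main : ∀ Ω : Finset (Fin (n + 2) → F), Ω ⊆ X → ∀ T ⊆ W, T.card + Ω.card = c →
      ∑ A ∈ powersetCard (n + 1) H,
        g A * ((∏ u ∈ T, hyperplaneForm A u) * ∏ w ∈ Ω, hyperplaneForm A w) = 0 := by
    intro Ω
    induction Ω using Finset.induction_on with
    | empty =>
      intro _ T hTW hT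
      rw [card_empty] at hT
      rw [← sum_arcWeight_pairs_eq_zero (E := W \ T) hS hcard hn hmp (by rw [hX]; exact hm)
        hQS hXS hYS (sdiff_subset.trans hWS) (by omega)
        (by rw [card_sdiff_of_subset hTW]; omega) hinj hY hQX hQXY (hHW.mono_right sdiff_subset)]
      refine sum_congr rfl fun A hA => ?_
      have hT0 : ∏ u ∈ T, hyperplaneForm A u ≠ 0 := prod_ne_zero_iff.2 fun u hu =>
        hne A hA u (hWS (hTW hu)) fun huA =>
          disjoint_left.1 hHW ((mem_powersetCard.1 hA).1 huA) (hTW hu)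
      simp only [g, f, prod_empty, mul_one]
      rw [← prod_sdiff hTW, mul_inv, ← hH]
      field_simp
    | insert w Ω hw ih =>
      intro hΩ T hTW hT
      rw [card_insert_of_notMem hw] at hT
      rw [insert_subset_iff] at hΩ
      -- `Q ∪ T'` has `m - 1 + c + 1 = k` vectors, hence is a basis. There is room for `T'` in `W \
      -- T` because `|T| ≤ c - 1` and `c + 2 ≤ m`.
      obtain ⟨T', hT'W, hT'⟩ := exists_subset_card_eq (s := W \ T) (n := c + 1)
        (by rw [card_sdiff_of_subset hTW]; omega)
      have hQT : Disjoint Q T' := (hHW.mono_left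
        (subset_union_left.trans subset_union_left)).mono_right (hT'W.trans sdiff_subset)
      have hspan := (hS (Q ∪ T') (union_subset hQS (hT'W.trans (sdiff_subset.trans hWS)))
        (by rw [card_union_of_disjoint hQT]; omega)).2
      have hwspan : w ∈ Submodule.span F ((Q ∪ T' : Finset (Fin (n + 2) → F)) : Set _) := by
        rw [hspan]; trivial
      obtain ⟨b, -, hb⟩ := Submodule.mem_span_finset.1 hwspan
      have hstep : ∀ A ∈ powersetCard (n + 1) H,
          g A * ((∏ u ∈ T, hyperplaneForm A u) * ∏ w ∈ insert w Ω, hyperplaneForm A w) =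
          ∑ v ∈ T', b v * (g A * ((∏ u ∈ insert v T, hyperplaneForm A u) *
            ∏ w ∈ Ω, hyperplaneForm A w)) := by
        intro A hA
        by_cases hgA : g A = 0
        · simp [hgA]
        have hQA := (hgQ A hA hgA).1
        -- The form vanishes on `Q ⊆ A`, so only the coordinates of `w` along `T'` count.
        have hw' : hyperplaneForm A w = ∑ v ∈ T', b v * hyperplaneForm A v := by
          conv_lhs => rw [← hb]
          rw [map_sum, sum_union hQT, sum_eq_zero (s := Q), zero_add]
          · simp
          · intro v hv
            rw [map_smul, hyperplaneForm_eq_zero (mem_powersetCard.1 hA).2 (hQA hv), smul_zero]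
        rw [prod_insert hw, hw', sum_mul, mul_sum, mul_sum]
        refine sum_congr rfl fun v hv => ?_
        rw [prod_insert (mem_sdiff.1 (hT'W hv)).2]
        ring
      rw [sum_congr rfl hstep, sum_comm]
      refine sum_eq_zero fun v hv => ?_
      have hvW := mem_sdiff.1 (hT'W hv)
      rw [← mul_sum, ih hΩ.2 (insert v T) (insert_subset hvW.1 hTW)
        (by rw [card_insert_of_notMem hvW.2]; omega), mul_zero]
  have hfin := main X subset_rfl ∅ (empty_subset _) (by simpa using hX)
  have hQY : Disjoint Q Y := hQXY.mono_left subset_union_left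
  have hXY : Disjoint X Y := hQXY.mono_left subset_union_right
  have hA₀ : Q ∪ Y ∈ powersetCard (n + 1) H := by
    rw [mem_powersetCard, card_union_of_disjoint hQY]
    exact ⟨union_subset (subset_union_left.trans subset_union_left) subset_union_right, by omega⟩
  have hX₀ : Disjoint X (Q ∪ Y) := disjoint_union_right.2 ⟨hQX.symm, hXY⟩
  rw [sum_eq_single_of_mem _ hA₀] at hfin
  · refine absurd hfin (mul_ne_zero (mul_ne_zero ?_ (mul_ne_zero (mul_ne_zero ?_ ?_) ?_))
      (mul_ne_zero ?_ ?_))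
    · refine prod_ne_zero_iff.2 fun v hv => ?_
      have h1 : v ∉ Q ∪ Y := disjoint_left.1 hX₀ hv
      have h2 : y v ∈ Q ∪ Y := mem_union_right _ (hY ▸ mem_image_of_mem _ hv)
      rw [memInd, memInd, if_neg h1, if_pos h2]
      simp
    · refine inv_ne_zero (prod_ne_zero_iff.2 fun u hu => ?_)
      exact hne _ hA₀ u (mem_sdiff.1 hu).1 (mem_sdiff.1 hu).2
    · refine inv_ne_zero (prod_ne_zero_iff.2 fun u hu => ?_)
      exact hne _ hA₀ u (hHS (mem_sdiff.1 hu).1) (mem_sdiff.1 hu).2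
    · refine inv_ne_zero (prod_ne_zero_iff.2 fun u hu => ?_)
      exact hne _ hA₀ u (hWS hu) fun h =>
        disjoint_left.1 hHW ((mem_powersetCard.1 hA₀).1 h) hu
    · simp
    · exact prod_ne_zero_iff.2 fun u hu => hne _ hA₀ u (hXS hu) (disjoint_left.1 hX₀ hu)
  · intro A hA hAne
    by_cases hgA : g A = 0
    · rw [hgA, zero_mul]
    have : ¬ Disjoint X A := fun h => hAne ((hgQ A hA hgA).2 h)
    obtain ⟨v, hvX, hvA⟩ := not_disjoint_iff.1 this
    rw [prod_eq_zero (i := v) hvX (hyperplaneForm_eq_zero (mem_powersetCard.1 hA).2 hvA)]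
    simp

/-- One vector is sent to infinity; the others have distinct slopes in `F`. -/
lemma EverySubsetIsBasis.card_le_of_plane [Fintype F] {S : Finset (Fin 2 → F)}
    (hS : EverySubsetIsBasis S) : S.card ≤ Fintype.card F + 1 := by
  classical
  by_contra! hlt
  obtain ⟨e₀, he₀⟩ : S.Nonempty := card_pos.1 (by omega)
  obtain ⟨e₁, he₁⟩ : (S.erase e₀).Nonempty := by
    apply card_pos.1; rw [card_erase_of_mem he₀]; omega
  have hne : ∀ u ∈ S, ∀ v ∈ S, u ≠ v → pencilForm (∅ : Finset (Fin 2 → F)) u v ≠ 0 :=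
    fun u hu v hv huv => hS.pencilForm_ne_zero (n := 0) (empty_subset _) card_empty hu
      (notMem_empty _) hv (notMem_empty _) huv
  have hinj := (pencilForm_isPlaneForm (∅ : Finset (Fin 2 → F))).slope_injOn
    (S := (S.erase e₀ : Finset _)) (hne e₀ he₀ e₁ (mem_of_mem_erase he₁)
      (ne_of_mem_erase he₁).symm)
    (fun s hs => hne e₀ he₀ s (mem_of_mem_erase hs) (ne_of_mem_erase hs).symm)
    (fun s hs a ha => hne s (mem_of_mem_erase hs) a (mem_of_mem_erase ha))
  have h1 := card_le_univ ((S.erase e₀).image fun s =>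
    pencilForm (∅ : Finset (Fin 2 → F)) e₁ s / pencilForm (∅ : Finset (Fin 2 → F)) e₀ s)
  rw [card_image_of_injOn hinj, card_erase_of_mem he₀] at h1
  omega

end Arcs

theorem mainTheorem2 {F : Type*} [Field F] [Fintype F] (p h k : ℕ) (hp : p.Prime)
    (hq : Fintype.card F = p ^ h) (hnp : ¬ (Fintype.card F).Prime) (hk : k ≤ 2 * p - 2)
    (S : Finset (Fin k → F)) (hS : EverySubsetIsBasis S) :
    S.card ≤ Fintype.card F + 1 := by
  classical
  have : Fact p.Prime := ⟨hp⟩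
  have : CharP F p := charP_of_card_eq_prime_pow hq
  have hp2 := hp.two_le
  have hq1 : 1 < Fintype.card F := Fintype.one_lt_card
  have hqp : p * p ≤ Fintype.card F := by
    have h2 : 2 ≤ h := by
      by_contra! hlt
      interval_cases h
      · simp at hq; omega
      · rw [pow_one] at hq; exact hnp (hq ▸ hp)
    rw [hq, ← pow_two]
    exact Nat.pow_le_pow_right hp.pos h2
  match k, S, hS with
  | 0, S, _ => exact (Finset.card_le_univ S).trans (by simp)
  | 1, S, _ => exact (Finset.card_le_univ S).trans (by simp)
  | 2, S, hS => exact hS.card_le_of_plane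
  | n + 3, S, hS =>
    by_contra! hlt
    obtain ⟨S', hS'S, hS'⟩ := Finset.exists_subset_card_eq (s := S) (n := Fintype.card F + 2) hlt
    rcases le_or_gt (n + 3) p with hle | hgt
    · exact (hS.mono hS'S).false_of_params (n := n + 1) (p := p) (m := n + 3) (c := 0) hS'
        (by omega) hle (by omega) (by omega) (Or.inl rfl) (by nlinarith)
    -- With `m = p` and `c = k - p`, the bound `k ≤ 2p - 2` is exactly `c + 2 ≤ m`. The size
    -- condition holds since `2m + 3c ≤ 5p - 6` and `p ^ 2 ≤ q`.
    · have hp3 : 3 ≤ p := by omega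
      exact (hS.mono hS'S).false_of_params (n := n + 1) (p := p) (m := p) (c := n + 3 - p) hS'
        (by omega) le_rfl (by omega) (by omega) (Or.inr (by omega)) (by
          have : 5 * p ≤ p * p + 7 := by nlinarith
          omega)
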